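/- For points $z_1,\dots,z_n\in\mathbb C$ put $\Delta(z_1,\dots,z_n)=\prod_{i\ne j}|z_i-z_j|$ (the product over ordered pairs), and let $$\Delta_{\max}(n)=\sup\bigl\{\Delta(z_1,\dots,z_n):\ |z_i-z_j|\le 2\text{ for all }i,j\bigr\},\qquad \overline\Delta_{\max}(n)=\frac{\Delta_{\max}(n)}{n^n}.$$ For a configuration $z=(z_1,\dots,z_n)$ of positive diameter $d=\max_{i,j}|z_i-z_j|$, let $\overline\Delta(z)=\Delta\bigl(\tfrac{2}{d} z_1,\dots,\tfrac{2}{d} z_n\bigr)/n^n$ be its normalized value, computed after rescaling to diameter $2$. Then $$\overline\Delta_{\max}(5)=\left(\tfrac45\right)^5(\sqrt5-1)^{10}.$$ The supremum $\Delta_{\max}(5)$ is attained by a configuration of diameter $2$. A configuration of five points with all distances $|z_i-z_j|\le 2$ satisfies $\Delta(z_1,\dots,z_5)=\Delta_{\max}(5)$ if and only if its points are, in some order, the vertices of a regular pentagon of diameter $2$. Equivalently, a configuration $z$ of five points of positive diameter satisfies $\overline\Delta(z)=\overline\Delta_{\max}(5)$ if and only if its points are, in some order, the vertices of a regular pentagon.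 -/

import Mathlib

noncomputable section

namespace PointConfiguration

/-- `Δ(z₁, …, zₙ) = ∏_{i ≠ j} |z_i - z_j|`, the product over ordered pairs. -/
def delta {n : ℕ} (z : Fin n → ℂ) : ℝ :=
  ∏ p ∈ (Finset.univ : Finset (Fin n)).offDiag, ‖z p.1 - z p.2‖

/-- The diameter of the (finite) point set `{z₁, …, zₙ}`. -/
def diameter {n : ℕ} (z : Fin n → ℂ) : ℝ :=
  Metric.diam (Set.range z)

/-- The standard diameter constraint: all mutual distances are at most `2`. -/
def Feasible {n : ℕ} (z : Fin n → ℂ) : Prop :=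
  ∀ i j, ‖z i - z j‖ ≤ 2

/-- The supremum of `Δ` over all feasible configurations of `n` points. -/
def deltaMax (n : ℕ) : ℝ :=
  sSup {d : ℝ | ∃ z : Fin n → ℂ, Feasible z ∧ d = delta z}

/-- `Δ(P) / nⁿ`, after rescaling the configuration to have diameter `2`. -/
def normalizedDelta {n : ℕ} (z : Fin n → ℂ) : ℝ :=
  delta (fun i => ((2 / diameter z : ℝ) : ℂ) * z i) / (n : ℝ) ^ n

/-- The maximal normalized value `Δ_max(n) / nⁿ`. -/
def normalizedDeltaMax (n : ℕ) : ℝ :=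
  deltaMax n / (n : ℝ) ^ n

/-- The points `z₁, …, zₙ` are, in some order, the vertices of a (nondegenerate) regular `n`-gon
with centre `c`; `w` is the vector from the centre to one of the vertices. -/
def IsRegularPolygon {n : ℕ} (z : Fin n → ℂ) : Prop :=
  ∃ (σ : Equiv.Perm (Fin n)) (c w : ℂ), w ≠ 0 ∧
    ∀ k : Fin n, z (σ k) =
      c + w * Complex.exp (2 * (Real.pi : ℂ) * Complex.I * ((k : ℕ) : ℂ) / (n : ℂ))

end PointConfiguration

end

namespace PointConfiguration

/-! Write s = √5 - 1, the side of a regular pentagon of diameter 2; its diagonals are 2. The value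
to reach is (32 s⁵)², since ordered pairs count each distance twice.

For five points in convex position, the five diagonals contribute at most 2⁵. The sides are
controlled by Reinhardt's inequality (`pentagon_perimeter_le`): a convex pentagon of diameter at
most 2 has perimeter at most 5s, so by AM-GM the product of its sides is at most s⁵. Equality makes
every side s and every diagonal 2, and then each side is the previous one rotated by 2π/5
(`sub_eq_zeta_mul`), so the pentagon is regular.

Reinhardt's inequality is a discrete Cauchy-Crofton argument. The sides of a convex polygon,
projected to a line, have total length at most twice the width (`cyclic_variation_le`). Testing this
against the five chords of a half circle cut at the side directions bounds the perimeter by a sum of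
sines of half gaps, to which Jensen applies (`sum_norm_le_of_projections`).

Otherwise two points coincide and the product vanishes, or some point lies in a triangle of three
others (`hasInnerPoint_or_exists_order`). Its distances to the three vertices have product at most 2
(`InTriangle.prod_le`), its distance to the fifth point is at most 2, and the other four points obey
a four-point bound from the same perimeter inequality. The resulting total is strictly below 32 s⁵.
-/

/-! ### Total length of five vectors from their projections. -/

open Real in
theorem sin_pi_div_ten : sin (π / 10) = (√5 - 1) / 4 := by
  have h : sin (π / 10) = cos (2 * (π / 5)) := by
    rw [← Real.cos_pi_div_two_sub]; congr 1; ring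
  rw [h, Real.cos_two_mul, Real.cos_pi_div_five]
  have := Real.sq_sqrt (show (0:ℝ) ≤ 5 by norm_num)
  linear_combination this / 8

/-- Every complex number is, up to sign, a nonnegative multiple of a unit vector in the closed
upper half plane. -/
theorem exists_direction (v : ℂ) : ∃ θ : ℝ, 0 ≤ θ ∧ θ ≤ Real.pi ∧ ∀ u : ℂ,
    |inner ℝ v u| = ‖v‖ * |inner ℝ (Complex.exp (θ * Complex.I)) u| := by
  have hv := Complex.norm_mul_exp_arg_mul_I v
  have key : ∀ u : ℂ, |inner ℝ v u| =
      ‖v‖ * |inner ℝ (Complex.exp (v.arg * Complex.I)) u| := by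
    intro u
    conv_lhs => rw [← hv, ← Complex.real_smul, real_inner_smul_left, abs_mul, abs_norm]
  rcases le_total 0 v.arg with h | h
  · exact ⟨v.arg, h, Complex.arg_le_pi v, key⟩
  · refine ⟨v.arg + Real.pi, by linarith [Complex.neg_pi_lt_arg v], by linarith, fun u => ?_⟩
    rw [key u]
    push_cast
    rw [add_mul, Complex.exp_add, Complex.exp_pi_mul_I, mul_neg_one, inner_neg_left, abs_neg]

theorem norm_exp_sub_exp (a b : ℝ) :
    ‖Complex.exp (b * Complex.I) - Complex.exp (a * Complex.I)‖ = 2 * |Real.sin ((b - a) / 2)| := by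
  have h : Complex.exp (b * Complex.I) - Complex.exp (a * Complex.I) =
      Complex.exp (a * Complex.I) * (Complex.exp (Complex.I * ((b - a : ℝ) : ℂ)) - 1) := by
    rw [mul_sub, ← Complex.exp_add, mul_one]
    congr 2
    push_cast
    ring
  rw [h, norm_mul, Complex.norm_exp_ofReal_mul_I, Complex.norm_exp_I_mul_ofReal_sub_one, one_mul,
    Real.norm_eq_abs, abs_mul, abs_two]

/-- Jensen's inequality for five half-angles adding up to `π / 2`. -/
theorem sum_abs_sin_half_le (δ : Fin 5 → ℝ) (h0 : ∀ j, 0 ≤ δ j) (hs : ∑ j, δ j = Real.pi) :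
    ∑ j, |Real.sin (δ j / 2)| ≤ 5 * Real.sin (Real.pi / 10) := by
  have hle : ∀ j, δ j ≤ Real.pi := fun j => by
    rw [← hs]; exact Finset.single_le_sum (fun i _ => h0 i) (Finset.mem_univ j)
  have hmem : ∀ j, δ j / 2 ∈ Set.Icc 0 Real.pi := fun j =>
    ⟨by linarith [h0 j], by linarith [hle j, Real.pi_pos]⟩
  have habs : ∀ j, |Real.sin (δ j / 2)| = Real.sin (δ j / 2) := fun j =>
    abs_of_nonneg (Real.sin_nonneg_of_mem_Icc (hmem j))
  have hJ := strictConcaveOn_sin_Icc.concaveOn.le_map_sum (t := Finset.univ)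
    (w := fun _ : Fin 5 => (1 / 5 : ℝ)) (p := fun j => δ j / 2)
    (fun _ _ => by norm_num) (by norm_num) (fun j _ => hmem j)
  simp only [smul_eq_mul, ← Finset.mul_sum, ← Finset.sum_div, hs] at hJ
  simp only [habs]
  rw [show 1 / 5 * (Real.pi / 2) = Real.pi / 10 by ring] at hJ
  linarith

/-- Five plane vectors whose projections to every line have bounded total length have bounded total
length, with the constant of the regular pentagon. -/
theorem sum_norm_le_of_projections (v : Fin 5 → ℂ) (W : ℝ) (hW : 0 ≤ W)
    (h : ∀ u : ℂ, ∑ k, |inner ℝ (v k) u| ≤ W * ‖u‖) :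
    ∑ k, ‖v k‖ ≤ W * (5 * Real.sin (Real.pi / 10)) := by
  choose θ h0 hpi hθ using fun k => exists_direction (v k)
  set σ := Tuple.sort θ
  have hmono : Monotone (θ ∘ σ) := Tuple.monotone_sort θ
  set t : Fin 5 → ℝ := θ ∘ σ with ht
  set E : ℝ → ℂ := fun x => Complex.exp (x * Complex.I) with hE
  have hEE : ∀ x, inner ℝ (E x) (E x) = 1 := fun x => by
    rw [real_inner_self_eq_norm_sq, Complex.norm_exp_ofReal_mul_I, one_pow]
  have hEpi : ∀ x, E (x + Real.pi) = - E x := fun x => by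
    simp only [hE]; push_cast; rw [add_mul, Complex.exp_add, Complex.exp_pi_mul_I, mul_neg_one]
  -- The chords of the path E(t 0), …, E(t 4), -E(t 0) on the unit circle; the angular gaps `δ` sum
  -- to π.
  set d : Fin 5 → ℂ := ![E (t 1) - E (t 0), E (t 2) - E (t 1), E (t 3) - E (t 2),
    E (t 4) - E (t 3), E (t 0 + Real.pi) - E (t 4)] with hd
  set δ : Fin 5 → ℝ := ![t 1 - t 0, t 2 - t 1, t 3 - t 2, t 4 - t 3, t 0 + Real.pi - t 4] with hδ
  have hnorm : ∀ j, ‖d j‖ = 2 * |Real.sin (δ j / 2)| := by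
    intro j; fin_cases j <;> exact norm_exp_sub_exp _ _
  have hδ0 : ∀ j, 0 ≤ δ j := by
    intro j
    fin_cases j
    · exact sub_nonneg.2 (hmono (by decide : (0 : Fin 5) ≤ 1))
    · exact sub_nonneg.2 (hmono (by decide : (1 : Fin 5) ≤ 2))
    · exact sub_nonneg.2 (hmono (by decide : (2 : Fin 5) ≤ 3))
    · exact sub_nonneg.2 (hmono (by decide : (3 : Fin 5) ≤ 4))
    · have h1 : 0 ≤ t 0 := h0 _
      have h2 : t 4 ≤ Real.pi := hpi _
      change 0 ≤ t 0 + Real.pi - t 4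
      linarith
  have hδs : ∑ j, δ j = Real.pi := by
    rw [Fin.sum_univ_five]
    change t 1 - t 0 + (t 2 - t 1) + (t 3 - t 2) + (t 4 - t 3) + (t 0 + Real.pi - t 4) = _
    ring
  -- Projected to the direction E(t k), the path goes from x to 1, at its vertex E(t k), and then to
  -- -x, so its variation is at least (1 - x) + (1 + x) = 2.
  have htwo : ∀ k, 2 ≤ ∑ j, |inner ℝ (E (t k)) (d j)| := by
    intro k
    have hk := hEE (t k)
    rw [Fin.sum_univ_five]
    change 2 ≤ |inner ℝ (E (t k)) (E (t 1) - E (t 0))| + |inner ℝ (E (t k)) (E (t 2) - E (t 1))| +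
      |inner ℝ (E (t k)) (E (t 3) - E (t 2))| + |inner ℝ (E (t k)) (E (t 4) - E (t 3))| +
      |inner ℝ (E (t k)) (E (t 0 + Real.pi) - E (t 4))|
    rw [hEpi]
    simp only [inner_sub_right, inner_neg_right]
    generalize hx0 : inner ℝ (E (t k)) (E (t 0)) = x0
    generalize hx1 : inner ℝ (E (t k)) (E (t 1)) = x1
    generalize hx2 : inner ℝ (E (t k)) (E (t 2)) = x2
    generalize hx3 : inner ℝ (E (t k)) (E (t 3)) = x3
    generalize hx4 : inner ℝ (E (t k)) (E (t 4)) = x4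
    have a0 := abs_le.1 (le_refl |x1 - x0|)
    have a1 := abs_le.1 (le_refl |x2 - x1|)
    have a2 := abs_le.1 (le_refl |x3 - x2|)
    have a3 := abs_le.1 (le_refl |x4 - x3|)
    have a4 := abs_le.1 (le_refl |-x0 - x4|)
    fin_cases k <;> simp only [Fin.zero_eta, Fin.mk_one, Fin.reduceFinMk] at hx0 hx1 hx2 hx3 hx4 hk
    · linarith [hk.symm.trans hx0]
    · linarith [hk.symm.trans hx1]
    · linarith [hk.symm.trans hx2]
    · linarith [hk.symm.trans hx3]
    · linarith [hk.symm.trans hx4]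
  have hsum : ∑ k, ‖v (σ k)‖ = ∑ k, ‖v k‖ := Equiv.sum_comp σ fun k => ‖v k‖
  -- Double counting of the pairings of vectors with chords: from below vector by vector, from above
  -- chord by chord.
  have h1 : 2 * ∑ k, ‖v k‖ ≤ ∑ k, ∑ j, |inner ℝ (v (σ k)) (d j)| := by
    rw [← hsum, Finset.mul_sum]
    refine Finset.sum_le_sum fun k _ => ?_
    simp only [hθ]
    rw [← Finset.mul_sum, mul_comm]
    exact mul_le_mul_of_nonneg_left (htwo k) (norm_nonneg _)
  have h2 : ∑ k, ∑ j, |inner ℝ (v (σ k)) (d j)| ≤ ∑ j, W * ‖d j‖ := by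
    rw [Finset.sum_comm]
    refine Finset.sum_le_sum fun j _ => ?_
    rw [Equiv.sum_comp σ fun k => |inner ℝ (v k) (d j)|]
    exact h (d j)
  have h3 := mul_le_mul_of_nonneg_left (sum_abs_sin_half_le δ hδ0 hδs) hW
  simp only [hnorm] at h2
  rw [← Finset.mul_sum, ← Finset.mul_sum] at h2
  linarith

/-! ### Variation of cyclic sequences. -/

/-- Four reals in cyclic order do not strictly alternate. -/
def NotAlternating (a b c d : ℝ) : Prop :=
  (a ≤ b ∨ a ≤ d ∨ c ≤ b ∨ c ≤ d) ∧ (b ≤ a ∨ b ≤ c ∨ d ≤ a ∨ d ≤ c)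

/-- After normalization, a weighted mean of a and c equals a weighted mean of b and d, so neither
pair can lie strictly above the other. -/
theorem notAlternating_of_combination {a b c d p q r s : ℝ} (hp : 0 < p) (hq : 0 < q) (hr : 0 < r)
    (hs : 0 < s) (hsum : p + r = q + s) (h : p * a + r * c = q * b + s * d) :
    NotAlternating a b c d := by
  constructor <;> by_contra! hc <;> obtain ⟨h1, h2, h3, h4⟩ := hc
  · rcases le_total b d with hbd | hbd
    · nlinarith [mul_pos hp (sub_pos.2 h2), mul_pos hr (sub_pos.2 h4),
        mul_nonneg hq.le (sub_nonneg.2 hbd), congrArg (· * d) hsum]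
    · nlinarith [mul_pos hp (sub_pos.2 h1), mul_pos hr (sub_pos.2 h3),
        mul_nonneg hs.le (sub_nonneg.2 hbd), congrArg (· * b) hsum]
  · rcases le_total b d with hbd | hbd
    · nlinarith [mul_pos hp (sub_pos.2 h1), mul_pos hr (sub_pos.2 h2),
        mul_nonneg hs.le (sub_nonneg.2 hbd), congrArg (· * b) hsum]
    · nlinarith [mul_pos hp (sub_pos.2 h3), mul_pos hr (sub_pos.2 h4),
        mul_nonneg hq.le (sub_nonneg.2 hbd), congrArg (· * d) hsum]

/-- A cyclic sequence of five reals without alternating quadruples has total variation at most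
twice its oscillation. -/
theorem cyclic_variation_le {a b c d e w : ℝ}
    (h0 : NotAlternating a b c d) (h1 : NotAlternating a b c e) (h2 : NotAlternating a b d e)
    (h3 : NotAlternating a c d e) (h4 : NotAlternating b c d e)
    (ab : |a - b| ≤ w) (ac : |a - c| ≤ w) (ad : |a - d| ≤ w) (ae : |a - e| ≤ w)
    (bc : |b - c| ≤ w) (bd : |b - d| ≤ w) (be : |b - e| ≤ w) (cd : |c - d| ≤ w)
    (ce : |c - e| ≤ w) (de : |d - e| ≤ w) :
    |b - a| + |c - b| + |d - c| + |e - d| + |a - e| ≤ 2 * w := by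
  rw [abs_le] at ab ac ad ae bc bd be cd ce de
  obtain ⟨h0, h0'⟩ := h0
  obtain ⟨h1, h1'⟩ := h1
  obtain ⟨h2, h2'⟩ := h2
  obtain ⟨h3, h3'⟩ := h3
  obtain ⟨h4, h4'⟩ := h4
  -- With at most one cyclic rise and fall the variation telescopes to twice a difference. With two
  -- of each, non-alternation of the two local maxima and two local minima puts some maximum at or
  -- below some minimum; those two drop out and leave at most twice a difference.
  rcases abs_cases (b - a) with ⟨e1, _⟩ | ⟨e1, _⟩ <;>
  rcases abs_cases (c - b) with ⟨e2, _⟩ | ⟨e2, _⟩ <;>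
  rcases abs_cases (d - c) with ⟨e3, _⟩ | ⟨e3, _⟩ <;>
  rcases abs_cases (e - d) with ⟨e4, _⟩ | ⟨e4, _⟩ <;>
  rcases abs_cases (a - e) with ⟨e5, _⟩ | ⟨e5, _⟩ <;>
  rw [e1, e2, e3, e4, e5] <;> clear e1 e2 e3 e4 e5 <;>
  first
  | linarith
  | (rcases h0 with h | h | h | h <;> linarith)
  | (rcases h1 with h | h | h | h <;> linarith)
  | (rcases h2 with h | h | h | h <;> linarith)
  | (rcases h3 with h | h | h | h <;> linarith)
  | (rcases h4 with h | h | h | h <;> linarith)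
  | (rcases h0' with h | h | h | h <;> linarith)
  | (rcases h1' with h | h | h | h <;> linarith)
  | (rcases h2' with h | h | h | h <;> linarith)
  | (rcases h3' with h | h | h | h <;> linarith)
  | (rcases h4' with h | h | h | h <;> linarith)

/-! ### Convex position or a point in a triangle. -/

/-- Twice the signed area of the triangle `a b c`. -/
def orient (a b c : ℂ) : ℝ :=
  (b.re - a.re) * (c.im - a.im) - (b.im - a.im) * (c.re - a.re)

/-- `e` lies in the closed triangle `a b c`. -/
def InTriangle (e a b c : ℂ) : Prop :=
  ∃ α β γ : ℝ, 0 ≤ α ∧ 0 ≤ β ∧ 0 ≤ γ ∧ α + β + γ = 1 ∧ e = α * a + β * b + γ * c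

/-- The ratios of signed areas are the barycentric coordinates. -/
theorem inTriangle_of_orient {a b c e : ℂ} (h : 0 < orient a b c) (h1 : 0 ≤ orient e b c)
    (h2 : 0 ≤ orient a e c) (h3 : 0 ≤ orient a b e) : InTriangle e a b c := by
  refine ⟨orient e b c / orient a b c, orient a e c / orient a b c, orient a b e / orient a b c,
    by positivity, by positivity, by positivity, ?_, ?_⟩
  · field_simp
    unfold orient
    ring
  · have h' : orient a b c ≠ 0 := h.ne'
    apply Complex.ext
    · simp only [Complex.add_re, Complex.re_ofReal_mul]
      field_simp
      unfold orient
      ring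
    · simp only [Complex.add_im, Complex.im_ofReal_mul]
      field_simp
      unfold orient
      ring

/-- The convexity property of a counterclockwise quadrilateral, seen in a linear projection. -/
theorem notAlternating_of_orient {a b c d : ℂ} (h1 : 0 < orient b c d) (h2 : 0 < orient a c d)
    (h3 : 0 < orient a b d) (h4 : 0 < orient a b c) (u : ℂ) :
    NotAlternating (inner ℝ a u) (inner ℝ b u) (inner ℝ c u) (inner ℝ d u) := by
  refine notAlternating_of_combination h1 h2 h3 h4 ?_ ?_
  · unfold orient; ring
  · simp only [Complex.inner, Complex.mul_re, Complex.conj_re, Complex.conj_im]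
    unfold orient; ring

theorem cross_nonneg_of_arg_le {a b : ℂ} (ha : 0 ≤ a.re) (hb : 0 ≤ b.re) (h : a.arg ≤ b.arg) :
    0 ≤ a.re * b.im - a.im * b.re := by
  have h1 := abs_le.1 (Complex.abs_arg_le_pi_div_two_iff.2 ha)
  have h2 := abs_le.1 (Complex.abs_arg_le_pi_div_two_iff.2 hb)
  have hs : 0 ≤ Real.sin (b.arg - a.arg) :=
    Real.sin_nonneg_of_nonneg_of_le_pi (by linarith) (by linarith)
  rw [Real.sin_sub] at hs
  rw [← Complex.norm_mul_cos_arg a, ← Complex.norm_mul_cos_arg b, ← Complex.norm_mul_sin_arg a,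
    ← Complex.norm_mul_sin_arg b]
  have := mul_nonneg (mul_nonneg (norm_nonneg a) (norm_nonneg b)) hs
  linarith

/-- Lexicographic positivity. -/
def LexPos (a : ℂ) : Prop := 0 < a.re ∨ a.re = 0 ∧ 0 < a.im

theorem LexPos.re_nonneg {a : ℂ} (h : LexPos a) : 0 ≤ a.re := by
  rcases h with h | h
  · exact h.le
  · exact h.1.ge

theorem LexPos.exists_smul {a b : ℂ} (ha : LexPos a) (hb : LexPos b)
    (h : a.re * b.im - a.im * b.re = 0) : ∃ t : ℝ, 0 < t ∧ a = t * b := by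
  rcases hb with hb | ⟨hb, hb'⟩
  · have ha' : 0 < a.re := by
      rcases ha with ha | ⟨ha, ha'⟩
      · exact ha
      · rw [ha] at h
        nlinarith [mul_pos ha' hb]
    refine ⟨a.re / b.re, by positivity, ?_⟩
    apply Complex.ext
    · rw [Complex.re_ofReal_mul]; field_simp
    · rw [Complex.im_ofReal_mul]; field_simp; linarith
  · have ha0 : a.re = 0 := by
      rw [hb] at h
      have : a.re * b.im = 0 := by linarith
      exact (mul_eq_zero.1 this).resolve_right hb'.ne'
    have ha' : 0 < a.im := by
      rcases ha with ha | ha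
      · linarith
      · exact ha.2
    refine ⟨a.im / b.im, by positivity, ?_⟩
    apply Complex.ext
    · rw [Complex.re_ofReal_mul, ha0, hb, mul_zero]
    · rw [Complex.im_ofReal_mul]; field_simp

/-- The lexicographically least point sees all others in a half-open half plane, where sorting by
argument is sorting by orientation. -/
theorem exists_lexPos_sub {n : ℕ} (z : Fin (n + 1) → ℂ) (hz : Function.Injective z) :
    ∃ i₀, ∀ i, i ≠ i₀ → LexPos (z i - z i₀) := by
  obtain ⟨i₀, h⟩ := Finite.exists_min fun i => toLex ((z i).re, (z i).im)
  refine ⟨i₀, fun i hi => ?_⟩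
  have h' := h i
  rw [Prod.Lex.toLex_le_toLex] at h'
  rcases h' with h' | ⟨h1, h2⟩
  · left; simpa using h'
  · right
    refine ⟨by simp only [Complex.sub_re]; exact sub_eq_zero.2 h1.symm, ?_⟩
    simp only [Complex.sub_im, sub_pos]
    exact lt_of_le_of_ne h2 fun h3 => hi (hz (Complex.ext h1.symm h3.symm))

/-- Some point lies in a triangle spanned by three others. -/
def HasInnerPoint {n : ℕ} (z : Fin n → ℂ) : Prop :=
  ∃ i j k l, i ≠ j ∧ i ≠ k ∧ i ≠ l ∧ j ≠ k ∧ j ≠ l ∧ k ≠ l ∧ InTriangle (z i) (z j) (z k) (z l)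

theorem exists_ne_three {n : ℕ} (hn : 4 ≤ n) (i j k : Fin n) : ∃ l, l ≠ i ∧ l ≠ j ∧ l ≠ k := by
  obtain ⟨l, -, hl⟩ := Finset.exists_mem_notMem_of_card_lt_card
    (s := ({i, j, k} : Finset (Fin n))) (t := Finset.univ)
    (lt_of_le_of_lt Finset.card_le_three (by rw [Finset.card_univ, Fintype.card_fin]; omega))
  simp only [Finset.mem_insert, Finset.mem_singleton, not_or] at hl
  exact ⟨l, hl⟩

/-- A point on a segment lies in a degenerate way in any triangle having that segment as a side; the
fourth point, with weight 0, supplies the missing vertex. -/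
theorem hasInnerPoint_of_between {n : ℕ} (hn : 4 ≤ n) (z : Fin n → ℂ) {i j k : Fin n}
    (hij : i ≠ j) (hik : i ≠ k) (hjk : j ≠ k) {t : ℝ} (h0 : 0 ≤ t) (h1 : t ≤ 1)
    (h : z i - z j = t * (z k - z j)) : HasInnerPoint z := by
  obtain ⟨l, hi, hj, hk⟩ := exists_ne_three hn i j k
  refine ⟨i, j, k, l, hij, hik, hi.symm, hjk, hj.symm, hk.symm, 1 - t, t, 0, by linarith, h0,
    le_rfl, by ring, ?_⟩
  push_cast
  linear_combination h

/-- At least four distinct points are either counterclockwise in a suitable order, or one of them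
lies in a triangle of three others. -/
theorem hasInnerPoint_or_exists_order {n : ℕ} (hn : 4 ≤ n + 1) (z : Fin (n + 1) → ℂ)
    (hz : Function.Injective z) : HasInnerPoint z ∨ ∃ σ : Equiv.Perm (Fin (n + 1)),
      ∀ i j k, i < j → j < k → 0 < orient (z (σ i)) (z (σ j)) (z (σ k)) := by
  by_cases hin : HasInnerPoint z
  · exact Or.inl hin
  right
  obtain ⟨i₀, hpos⟩ := exists_lexPos_sub z hz
  -- The value -π lies strictly below every argument, so the base point is sorted first.
  set f : Fin (n + 1) → ℝ := fun i => if i = i₀ then -Real.pi else (z i - z i₀).arg with hf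
  set σ := Tuple.sort f
  have hmono : Monotone (f ∘ σ) := Tuple.monotone_sort f
  have hσ0 : σ 0 = i₀ := by
    by_contra h
    have h1 : f (σ 0) ≤ f (σ (σ.symm i₀)) := hmono (Fin.zero_le _)
    rw [Equiv.apply_symm_apply] at h1
    simp only [hf, h, if_false, if_true] at h1
    linarith [Complex.neg_pi_lt_arg (z (σ 0) - z i₀)]
  have hne : ∀ i, 0 < i → σ i ≠ i₀ := fun i hi h => by
    rw [← hσ0] at h
    exact hi.ne' (σ.injective h)
  have hbase : ∀ i j, 0 < i → i < j → 0 < orient (z i₀) (z (σ i)) (z (σ j)) := by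
    intro i j hi hij
    have hj := hi.trans hij
    have hpi := hpos _ (hne i hi)
    have hpj := hpos _ (hne j hj)
    have harg : f (σ i) ≤ f (σ j) := hmono hij.le
    simp only [hf, hne i hi, hne j hj, if_false] at harg
    have hcross := cross_nonneg_of_arg_le hpi.re_nonneg hpj.re_nonneg harg
    refine lt_of_le_of_ne hcross fun h0 => hin ?_
    have hσij : σ i ≠ σ j := fun h => hij.ne (σ.injective h)
    obtain ⟨t, ht, h⟩ := hpi.exists_smul hpj h0.symm
    rcases le_total t 1 with ht1 | ht1
    · exact hasInnerPoint_of_between hn z (hne i hi) hσij (hne j hj).symm ht.le ht1 h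
    · refine hasInnerPoint_of_between hn z (hne j hj) hσij.symm (hne i hi).symm
        (t := t⁻¹) (by positivity) (inv_le_one_of_one_le₀ ht1) ?_
      rw [h, Complex.ofReal_inv, inv_mul_cancel_left₀]
      exact_mod_cast ht.ne'
  refine ⟨σ, fun i j k hij hjk => ?_⟩
  rcases (Fin.zero_le i).eq_or_lt with rfl | hi
  · rw [hσ0]; exact hbase j k hij hjk
  · have h1 := hbase i j hi hij
    have h2 := hbase j k (hi.trans hij) hjk
    have h3 := hbase i k hi (hij.trans hjk)
    by_contra! hc
    -- A turn at j that is not strictly counterclockwise puts the j-th point in the triangle of the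
    -- base point and the points i and k.
    refine hin ⟨σ j, i₀, σ i, σ k, hne j (hi.trans hij), fun h => hij.ne (σ.injective h.symm),
      fun h => hjk.ne (σ.injective h), (hne i hi).symm, (hne k ((hi.trans hij).trans hjk)).symm,
      fun h => (hij.trans hjk).ne (σ.injective h),
      inTriangle_of_orient h3 ?_ h2.le h1.le⟩
    unfold orient at hc ⊢
    linarith

/-! ### Distances from a point of a triangle to its vertices. -/

theorem norm_le_of_convexCombination {a b c e : ℂ} {α β γ : ℝ} (hβ : 0 ≤ β) (hγ : 0 ≤ γ)
    (hs : α + β + γ = 1) (he : e = α * a + β * b + γ * c) (h1 : ‖b - a‖ ≤ 2) (h2 : ‖c - a‖ ≤ 2) :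
    ‖e - a‖ ≤ 2 * (1 - α) := by
  have hs' : (α : ℂ) + β + γ = 1 := by exact_mod_cast hs
  have h : e - a = β * (b - a) + γ * (c - a) := by
    rw [he]; linear_combination a * hs'
  rw [h]
  refine (norm_add_le _ _).trans ?_
  rw [norm_mul, norm_mul, Complex.norm_real, Complex.norm_real, Real.norm_of_nonneg hβ,
    Real.norm_of_nonneg hγ]
  nlinarith

theorem lagrange_identity {a b c e : ℂ} {α β γ : ℝ}
    (hs : α + β + γ = 1) (he : e = α * a + β * b + γ * c) :
    α * ‖e - a‖ ^ 2 + β * ‖e - b‖ ^ 2 + γ * ‖e - c‖ ^ 2 =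
      α * β * ‖a - b‖ ^ 2 + β * γ * ‖b - c‖ ^ 2 + γ * α * ‖c - a‖ ^ 2 := by
  have hγ : γ = 1 - α - β := by linarith
  subst hγ
  subst he
  simp only [← Complex.normSq_eq_norm_sq, Complex.normSq_apply, Complex.sub_re, Complex.sub_im,
    Complex.add_re, Complex.add_im, Complex.re_ofReal_mul, Complex.im_ofReal_mul]
  ring

theorem mul_one_sub_sq_le {α : ℝ} (h1 : α ≤ 1) : α * (1 - α) ^ 2 ≤ 4 / 27 := by
  nlinarith [mul_nonneg (sq_nonneg (3 * α - 1)) (by linarith : 0 ≤ 4 - 3 * α)]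

theorem schur_of_sum_eq_one {α β γ : ℝ} (hα : 0 ≤ α) (hβ : 0 ≤ β) (hγ : 0 ≤ γ)
    (hs : α + β + γ = 1) : 4 * (α * β + β * γ + γ * α) ≤ 1 + 9 * (α * β * γ) := by
  have h : 0 ≤ α * (α - β) * (α - γ) + β * (β - α) * (β - γ) + γ * (γ - α) * (γ - β) := by
    rcases le_total α β with h1 | h1 <;> rcases le_total β γ with h2 | h2 <;>
    rcases le_total α γ with h3 | h3 <;>
    nlinarith [mul_nonneg (sub_nonneg.2 h1) (sub_nonneg.2 h2),
      mul_nonneg (sub_nonneg.2 h1) (sub_nonneg.2 h3), mul_nonneg (sub_nonneg.2 h2) (sub_nonneg.2 h3),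
      mul_nonneg hα (mul_nonneg (sub_nonneg.2 h1) (sub_nonneg.2 h3)),
      mul_nonneg hβ (mul_nonneg (sub_nonneg.2 h1) (sub_nonneg.2 h2)),
      mul_nonneg hγ (mul_nonneg (sub_nonneg.2 h2) (sub_nonneg.2 h3)),
      mul_nonneg hα (sq_nonneg (β - γ)), mul_nonneg hβ (sq_nonneg (α - γ)),
      mul_nonneg hγ (sq_nonneg (α - β)),
      mul_nonneg (sub_nonneg.2 h1) (sq_nonneg (α - β)), mul_nonneg (sub_nonneg.2 h2) (sq_nonneg (γ - β)),
      mul_nonneg (sub_nonneg.2 h3) (sq_nonneg (α - γ))]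
  have hγ' : γ = 1 - α - β := by linarith
  subst hγ'
  nlinarith

/-- Turns relative deficits (X - x) / X into a multiplicative gain, so that deficits at the three
vertices add up. -/
theorem le_mul_exp {x X : ℝ} (hX : 0 < X) : x ≤ X * Real.exp (-(X - x) / X) := by
  have h := Real.add_one_le_exp (-(X - x) / X)
  have h2 : X * (-(X - x) / X + 1) = x := by field_simp; ring
  calc x = X * (-(X - x) / X + 1) := h2.symm
    _ ≤ _ := mul_le_mul_of_nonneg_left h hX.le

/-- A point of a triangle of diameter at most `2` has product of distances to the vertices at
most `2`. -/
theorem InTriangle.prod_le {a b c e : ℂ} (h : InTriangle e a b c) (hab : ‖a - b‖ ≤ 2)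
    (hbc : ‖b - c‖ ≤ 2) (hca : ‖c - a‖ ≤ 2) : ‖e - a‖ * ‖e - b‖ * ‖e - c‖ ≤ 2 := by
  obtain ⟨α, β, γ, hα, hβ, hγ, hs, he⟩ := h
  have hx := norm_le_of_convexCombination hβ hγ hs he (by rwa [norm_sub_rev]) hca
  have hy := norm_le_of_convexCombination (e := e) (a := b) (b := c) (c := a) (α := β) hγ hα (by linarith)
    (by rw [he]; ring) (by rwa [norm_sub_rev]) hab
  have hz := norm_le_of_convexCombination (e := e) (a := c) (b := a) (c := b) (α := γ) hα hβ (by linarith)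
    (by rw [he]; ring) (by rwa [norm_sub_rev]) hbc
  have hL := lagrange_identity hs he
  have hsq : ∀ w : ℂ, ‖w‖ ≤ 2 → ‖w‖ ^ 2 ≤ 4 := fun w hw => by nlinarith [norm_nonneg w]
  have hab' := mul_le_mul_of_nonneg_left (hsq _ hab) (mul_nonneg hα hβ)
  have hbc' := mul_le_mul_of_nonneg_left (hsq _ hbc) (mul_nonneg hβ hγ)
  have hca' := mul_le_mul_of_nonneg_left (hsq _ hca) (mul_nonneg hγ hα)
  have nx := norm_nonneg (e - a)
  have ny := norm_nonneg (e - b)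
  have nz := norm_nonneg (e - c)
  by_cases h1 : α = 1
  · have : ‖e - a‖ = 0 := by rw [h1] at hx; linarith
    rw [this]; norm_num
  by_cases h2 : β = 1
  · have : ‖e - b‖ = 0 := by rw [h2] at hy; linarith
    rw [this]; norm_num
  by_cases h3 : γ = 1
  · have : ‖e - c‖ = 0 := by rw [h3] at hz; linarith
    rw [this]; norm_num
  have hα1 : 0 < 1 - α := sub_pos.2 (lt_of_le_of_ne (by linarith) h1)
  have hβ1 : 0 < 1 - β := sub_pos.2 (lt_of_le_of_ne (by linarith) h2)
  have hγ1 : 0 < 1 - γ := sub_pos.2 (lt_of_le_of_ne (by linarith) h3)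
  set x := ‖e - a‖ ^ 2 with hx2
  set y := ‖e - b‖ ^ 2 with hy2
  set z := ‖e - c‖ ^ 2 with hz2
  have hxX : x ≤ (2 * (1 - α)) ^ 2 := pow_le_pow_left₀ nx hx 2
  have hyY : y ≤ (2 * (1 - β)) ^ 2 := pow_le_pow_left₀ ny hy 2
  have hzZ : z ≤ (2 * (1 - γ)) ^ 2 := pow_le_pow_left₀ nz hz 2
  set X := (2 * (1 - α)) ^ 2 with hX
  set Y := (2 * (1 - β)) ^ 2 with hY
  set Z := (2 * (1 - γ)) ^ 2 with hZ
  have pX : 0 < X := by positivity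
  have pY : 0 < Y := by positivity
  have pZ : 0 < Z := by positivity
  set t := α * β * γ with ht
  have t0 : 0 ≤ t := by positivity
  -- The bounds x ≤ X, y ≤ Y, z ≤ Z alone are too weak at the centroid. Lagrange's identity gives a
  -- weighted deficit of at least 12t; as αX ≤ 16/27, and likewise for the other two, the relative
  -- deficits sum to at least 12t · 27/16 ≥ 10t.
  have hdef : ∀ {ξ D d : ℝ}, 0 < D → d ≤ D → ξ * D ≤ 16 / 27 →
      ξ * (D - d) ≤ 16 / 27 * ((D - d) / D) := by
    intro ξ D d hD hd h
    have h2 := mul_le_mul_of_nonneg_right h (div_nonneg (sub_nonneg.2 hd) hD.le)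
    rwa [mul_assoc, mul_div_cancel₀ _ hD.ne'] at h2
  have e1 := hdef pX hxX (ξ := α) (by rw [hX]; linarith [mul_one_sub_sq_le (α := α) (by linarith)])
  have e2 := hdef pY hyY (ξ := β) (by rw [hY]; linarith [mul_one_sub_sq_le (α := β) (by linarith)])
  have e3 := hdef pZ hzZ (ξ := γ) (by rw [hZ]; linarith [mul_one_sub_sq_le (α := γ) (by linarith)])
  have hXYZ : α * X + β * Y + γ * Z = 4 * (α * β + β * γ + γ * α) + 12 * t := by
    have hγ' : γ = 1 - α - β := by linarith
    rw [hX, hY, hZ, ht, hγ']; ring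
  have hexp : 10 * t ≤ (X - x) / X + (Y - y) / Y + (Z - z) / Z := by linarith
  -- Schur gives XYZ ≤ 4(1 + 5t)², and the excess over 4 is absorbed by the gain exp(-10t).
  have hprod : X * Y * Z ≤ 4 * Real.exp (10 * t) := by
    have hS := schur_of_sum_eq_one hα hβ hγ hs
    have hE : (1 + 5 * t) ^ 2 ≤ Real.exp (5 * t) ^ 2 :=
      pow_le_pow_left₀ (by positivity) (by linarith [Real.add_one_le_exp (5 * t)]) 2
    rw [← Real.exp_nat_mul] at hE
    have hr : (1 - α) * (1 - β) * (1 - γ) ≤ (1 + 5 * t) / 4 := by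
      have hγ' : γ = 1 - α - β := by linarith
      have : (1 - α) * (1 - β) * (1 - γ) = (α * β + β * γ + γ * α) - t := by
        rw [ht, hγ']; ring
      rw [this]; linarith
    have hr2 := pow_le_pow_left₀ (by positivity) hr 2
    have : X * Y * Z = 64 * ((1 - α) * (1 - β) * (1 - γ)) ^ 2 := by rw [hX, hY, hZ]; ring
    rw [this]
    have e5 : ((2 : ℕ) : ℝ) * (5 * t) = 10 * t := by push_cast; ring
    rw [e5] at hE
    linarith
  have hxyz : x * y * z ≤ 4 := by
    calc x * y * z ≤ (X * Real.exp (-(X - x) / X)) * (Y * Real.exp (-(Y - y) / Y)) *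
          (Z * Real.exp (-(Z - z) / Z)) := by
          gcongr
          · exact le_mul_exp pX
          · exact le_mul_exp pY
          · exact le_mul_exp pZ
      _ = X * Y * Z * Real.exp (-((X - x) / X + (Y - y) / Y + (Z - z) / Z)) := by
          rw [neg_add, neg_add, Real.exp_add, Real.exp_add, neg_div, neg_div, neg_div]; ring
      _ ≤ 4 * Real.exp (10 * t) * Real.exp (-(10 * t)) := by gcongr
      _ = 4 := by rw [mul_assoc, ← Real.exp_add]; simp
  have : (‖e - a‖ * ‖e - b‖ * ‖e - c‖) ^ 2 ≤ 2 ^ 2 := by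
    rw [mul_pow, mul_pow]; linarith
  exact le_of_sq_le_sq this (by norm_num)

/-! ### The product of distances, and AM-GM. -/

theorem delta_comp_perm {n : ℕ} (z : Fin n → ℂ) (σ : Equiv.Perm (Fin n)) :
    delta (z ∘ σ) = delta z := by
  unfold delta
  refine Finset.prod_equiv (Equiv.prodCongr σ σ) (fun p => ?_) (fun p _ => rfl)
  simp [Finset.mem_offDiag]

theorem delta_eq_prod_prod {n : ℕ} (z : Fin n → ℂ) :
    delta z = ∏ i, ∏ j, if i ≠ j then ‖z i - z j‖ else 1 := by
  unfold delta
  rw [← Fintype.prod_prod_type' (f := fun i j => if i ≠ j then ‖z i - z j‖ else 1),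
    ← Finset.prod_filter]
  congr 1
  ext p
  simp [Finset.mem_offDiag]

theorem delta_four (z : Fin 4 → ℂ) : delta z =
    (‖z 1 - z 0‖ * ‖z 2 - z 1‖ * ‖z 3 - z 2‖ * ‖z 0 - z 3‖ * ‖z 2 - z 0‖ * ‖z 3 - z 1‖) ^ 2 := by
  rw [delta_eq_prod_prod]
  simp only [Fin.prod_univ_four]
  simp only [ne_eq, Fin.reduceEq, not_true_eq_false, not_false_eq_true, if_true, if_false]
  rw [norm_sub_rev (z 0) (z 1), norm_sub_rev (z 0) (z 2), norm_sub_rev (z 3) (z 0),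
    norm_sub_rev (z 1) (z 2), norm_sub_rev (z 1) (z 3), norm_sub_rev (z 2) (z 3)]
  ring

theorem delta_five (z : Fin 5 → ℂ) : delta z =
    ((‖z 1 - z 0‖ * ‖z 2 - z 1‖ * ‖z 3 - z 2‖ * ‖z 4 - z 3‖ * ‖z 0 - z 4‖) *
    (‖z 2 - z 0‖ * ‖z 3 - z 1‖ * ‖z 4 - z 2‖ * ‖z 0 - z 3‖ * ‖z 1 - z 4‖)) ^ 2 := by
  rw [delta_eq_prod_prod]
  simp only [Fin.prod_univ_five]
  simp only [ne_eq, Fin.reduceEq, not_true_eq_false, not_false_eq_true, if_true, if_false]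
  rw [norm_sub_rev (z 0) (z 1), norm_sub_rev (z 0) (z 2), norm_sub_rev (z 3) (z 0),
    norm_sub_rev (z 1) (z 2), norm_sub_rev (z 1) (z 3), norm_sub_rev (z 2) (z 3),
    norm_sub_rev (z 4) (z 0), norm_sub_rev (z 4) (z 1), norm_sub_rev (z 2) (z 4),
    norm_sub_rev (z 3) (z 4)]
  ring

theorem delta_eq_zero_of_not_injective {n : ℕ} {z : Fin n → ℂ} (h : ¬ Function.Injective z) :
    delta z = 0 := by
  simp only [Function.Injective, not_forall] at h
  obtain ⟨i, j, hij, hne⟩ := h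
  exact Finset.prod_eq_zero (i := (i, j)) (by simpa [Finset.mem_offDiag] using hne) (by simp [hij])

/-- Equality case included: nonnegative numbers with mean at most `1` have product at most `1`. -/
theorem prod_le_one_of_sum_le {n : ℕ} (r : Fin n → ℝ) (h0 : ∀ k, 0 ≤ r k) (hs : ∑ k, r k ≤ n) :
    ∏ k, r k ≤ 1 ∧ (∏ k, r k = 1 → ∀ k, r k = 1) := by
  -- AM-GM through r ≤ exp(r - 1), which is strict unless r = 1.
  have hE : ∏ k, Real.exp (r k - 1) ≤ 1 := by
    rw [← Real.exp_sum, Real.exp_le_one_iff, Finset.sum_sub_distrib]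
    simpa using hs
  have hle : ∀ k, r k ≤ Real.exp (r k - 1) := fun k => by
    linarith [Real.add_one_le_exp (r k - 1)]
  refine ⟨(Finset.prod_le_prod (fun k _ => h0 k) fun k _ => hle k).trans hE, fun h k => ?_⟩
  by_contra hk
  have hpos : ∀ i, 0 < r i := fun i => lt_of_le_of_ne (h0 i) fun hi => by
    rw [Finset.prod_eq_zero (Finset.mem_univ i) hi.symm] at h
    exact zero_ne_one h
  have hlt : ∏ k, r k < ∏ k, Real.exp (r k - 1) :=
    Finset.prod_lt_prod (fun i _ => hpos i) (fun i _ => hle i) ⟨k, Finset.mem_univ k, by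
      linarith [Real.add_one_lt_exp (sub_ne_zero.2 hk)]⟩
  linarith

/-! ### The perimeter inequality and the non-convex case. -/

/-- Convexity enters only through projections, so repeated vertices are allowed and quadrilaterals
are covered. The factor 4 is twice the largest width 2. -/
theorem pentagon_perimeter_le {a b c d e : ℂ}
    (h0 : ∀ u, NotAlternating (inner ℝ a u) (inner ℝ b u) (inner ℝ c u) (inner ℝ d u))
    (h1 : ∀ u, NotAlternating (inner ℝ a u) (inner ℝ b u) (inner ℝ c u) (inner ℝ e u))
    (h2 : ∀ u, NotAlternating (inner ℝ a u) (inner ℝ b u) (inner ℝ d u) (inner ℝ e u))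
    (h3 : ∀ u, NotAlternating (inner ℝ a u) (inner ℝ c u) (inner ℝ d u) (inner ℝ e u))
    (h4 : ∀ u, NotAlternating (inner ℝ b u) (inner ℝ c u) (inner ℝ d u) (inner ℝ e u))
    (ab : ‖a - b‖ ≤ 2) (ac : ‖a - c‖ ≤ 2) (ad : ‖a - d‖ ≤ 2) (ae : ‖a - e‖ ≤ 2)
    (bc : ‖b - c‖ ≤ 2) (bd : ‖b - d‖ ≤ 2) (be : ‖b - e‖ ≤ 2) (cd : ‖c - d‖ ≤ 2)
    (ce : ‖c - e‖ ≤ 2) (de : ‖d - e‖ ≤ 2) :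
    ‖b - a‖ + ‖c - b‖ + ‖d - c‖ + ‖e - d‖ + ‖a - e‖ ≤ 5 * (√5 - 1) := by
  have h := sum_norm_le_of_projections ![b - a, c - b, d - c, e - d, a - e] 4 (by norm_num)
    fun u => ?_
  · rw [Fin.sum_univ_five, sin_pi_div_ten] at h
    calc _ ≤ 4 * (5 * ((√5 - 1) / 4)) := h
      _ = _ := by ring
  · have key : ∀ p q : ℂ, ‖p - q‖ ≤ 2 → |inner ℝ p u - inner ℝ q u| ≤ 2 * ‖u‖ := fun p q hpq => by
      rw [← inner_sub_left]
      exact (abs_real_inner_le_norm _ _).trans (mul_le_mul_of_nonneg_right hpq (norm_nonneg _))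
    have := cyclic_variation_le (h0 u) (h1 u) (h2 u) (h3 u) (h4 u) (key _ _ ab) (key _ _ ac)
      (key _ _ ad) (key _ _ ae) (key _ _ bc) (key _ _ bd) (key _ _ be) (key _ _ cd) (key _ _ ce)
      (key _ _ de)
    rw [Fin.sum_univ_five]
    change |inner ℝ (b - a) u| + |inner ℝ (c - b) u| + |inner ℝ (d - c) u| + |inner ℝ (e - d) u| +
      |inner ℝ (a - e) u| ≤ _
    simp only [inner_sub_left]
    linarith

theorem Feasible.comp {n m : ℕ} {z : Fin n → ℂ} (h : Feasible z) (f : Fin m → Fin n) :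
    Feasible (z ∘ f) := fun i j => h (f i) (f j)

/-- The condition of being in counterclockwise convex position. -/
def Ordered {n : ℕ} (z : Fin n → ℂ) : Prop :=
  ∀ i j k, i < j → j < k → 0 < orient (z i) (z j) (z k)

theorem Ordered.notAlternating {n : ℕ} {z : Fin n → ℂ} (h : Ordered z) {i j k l : Fin n}
    (hij : i < j) (hjk : j < k) (hkl : k < l) (u : ℂ) :
    NotAlternating (inner ℝ (z i) u) (inner ℝ (z j) u) (inner ℝ (z k) u) (inner ℝ (z l) u) :=
  notAlternating_of_orient (h j k l hjk hkl) (h i k l (hij.trans hjk) hkl)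
    (h i j l hij (hjk.trans hkl)) (h i j k hij hjk) u

/-- The non-convex case needs √5 - 1 > 625/512 ≈ 1.2207, which 1.23 leaves room for. -/
theorem one_lt_sqrt_five_sub_one : (1.23 : ℝ) < √5 - 1 := by
  have : (2.23 : ℝ) < √5 := Real.lt_sqrt_of_sq_lt (by norm_num)
  linarith

theorem prod_six_le {a b c d e f : ℝ} (hb : 0 ≤ b) (hc : 0 ≤ c) (hd : 0 ≤ d)
    (hf : 0 ≤ f) (a2 : a ≤ 2) (b2 : b ≤ 2) (c2 : c ≤ 2) (h : d * e * f ≤ 2) (he : 0 ≤ e) :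
    a * b * c * (d * e * f) ≤ 16 := by
  calc a * b * c * (d * e * f) ≤ 2 * 2 * 2 * 2 := by gcongr
    _ = 16 := by norm_num

theorem delta_four_le_of_inTriangle {z : Fin 4 → ℂ} (hz : Feasible z)
    (h : InTriangle (z 0) (z 1) (z 2) (z 3)) : delta z ≤ 16 ^ 2 := by
  have h1 := h.prod_le (hz 1 2) (hz 2 3) (hz 3 1)
  rw [delta_four]
  refine pow_le_pow_left₀ (by positivity) ?_ 2
  rw [norm_sub_rev (z 0) (z 1), norm_sub_rev (z 0) (z 2)] at h1
  have := prod_six_le (norm_nonneg _) (norm_nonneg _) (norm_nonneg _)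
    (norm_nonneg _) (hz 2 1) (hz 3 2) (hz 3 1) h1 (norm_nonneg _)
  linarith

theorem delta_four_le_of_ordered {z : Fin 4 → ℂ} (hz : Feasible z) (ho : Ordered z) :
    delta z ≤ (4 * (5 * (√5 - 1) / 4) ^ 4) ^ 2 := by
  have hs := one_lt_sqrt_five_sub_one
  -- The quadrilateral is treated as a pentagon whose last vertex is doubled.
  have hp : ‖z 1 - z 0‖ + ‖z 2 - z 1‖ + ‖z 3 - z 2‖ + ‖z 3 - z 3‖ + ‖z 0 - z 3‖ ≤ 5 * (√5 - 1) := by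
    refine pentagon_perimeter_le
      (ho.notAlternating (by decide) (by decide) (by decide))
      (ho.notAlternating (by decide) (by decide) (by decide)) (fun u => ?_) (fun u => ?_)
      (fun u => ?_) (hz _ _) (hz _ _) (hz _ _) (hz _ _) (hz _ _) (hz _ _) (hz _ _) (hz _ _)
      (hz _ _) (hz _ _) <;>
    exact ⟨Or.inr (Or.inr (Or.inr le_rfl)), Or.inr (Or.inr (Or.inr le_rfl))⟩
  rw [sub_self (z 3), norm_zero, add_zero] at hp
  set S := 5 * (√5 - 1) / 4 with hS
  have hS0 : 0 < S := by rw [hS]; linarith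
  have hA := (prod_le_one_of_sum_le
    ![‖z 1 - z 0‖ / S, ‖z 2 - z 1‖ / S, ‖z 3 - z 2‖ / S, ‖z 0 - z 3‖ / S]
    (fun k => by fin_cases k <;> exact div_nonneg (norm_nonneg _) hS0.le) (by
      rw [Fin.sum_univ_four]
      change ‖z 1 - z 0‖ / S + ‖z 2 - z 1‖ / S + ‖z 3 - z 2‖ / S + ‖z 0 - z 3‖ / S ≤ (4 : ℕ)
      rw [← add_div, ← add_div, ← add_div, div_le_iff₀ hS0]
      push_cast
      linarith)).1
  rw [Fin.prod_univ_four] at hA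
  change ‖z 1 - z 0‖ / S * (‖z 2 - z 1‖ / S) * (‖z 3 - z 2‖ / S) * (‖z 0 - z 3‖ / S) ≤ 1 at hA
  rw [div_mul_div_comm, div_mul_div_comm, div_mul_div_comm, div_le_one (by positivity)] at hA
  rw [delta_four]
  refine pow_le_pow_left₀ (by positivity) ?_ 2
  calc ‖z 1 - z 0‖ * ‖z 2 - z 1‖ * ‖z 3 - z 2‖ * ‖z 0 - z 3‖ * ‖z 2 - z 0‖ * ‖z 3 - z 1‖
      ≤ (S * S * S * S) * 2 * 2 := by
        gcongr
        · exact hz 2 0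
        · exact hz 3 1
    _ = _ := by ring

theorem exists_perm_of_hasInnerPoint_four {z : Fin 4 → ℂ} (h : HasInnerPoint z) :
    ∃ σ : Equiv.Perm (Fin 4), InTriangle (z (σ 0)) (z (σ 1)) (z (σ 2)) (z (σ 3)) := by
  obtain ⟨i, j, k, l, h1, h2, h3, h4, h5, h6, h⟩ := h
  have hinj : Function.Injective ![i, j, k, l] := by
    intro a b hab
    fin_cases a <;> fin_cases b <;> simp_all
  exact ⟨Equiv.ofBijective _ (Finite.injective_iff_bijective.1 hinj), h⟩

theorem exists_perm_of_hasInnerPoint_five {z : Fin 5 → ℂ} (h : HasInnerPoint z) :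
    ∃ σ : Equiv.Perm (Fin 5), InTriangle (z (σ 0)) (z (σ 1)) (z (σ 2)) (z (σ 3)) := by
  obtain ⟨i, j, k, l, h1, h2, h3, h4, h5, h6, h⟩ := h
  obtain ⟨m, -, hm⟩ := Finset.exists_mem_notMem_of_card_lt_card
    (s := ({i, j, k, l} : Finset (Fin 5))) (t := Finset.univ)
    (lt_of_le_of_lt Finset.card_le_four (by decide))
  simp only [Finset.mem_insert, Finset.mem_singleton, not_or] at hm
  obtain ⟨m1, m2, m3, m4⟩ := hm
  have hinj : Function.Injective ![i, j, k, l, m] := by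
    intro a b hab
    fin_cases a <;> fin_cases b <;> simp_all
  exact ⟨Equiv.ofBijective _ (Finite.injective_iff_bijective.1 hinj), h⟩

theorem delta_four_le {z : Fin 4 → ℂ} (hz : Feasible z) :
    delta z ≤ (4 * (5 * (√5 - 1) / 4) ^ 4) ^ 2 := by
  by_cases hinj : Function.Injective z
  · rcases hasInnerPoint_or_exists_order le_rfl z hinj with h | ⟨σ, hσ⟩
    · obtain ⟨σ, hσ⟩ := exists_perm_of_hasInnerPoint_four h
      rw [← delta_comp_perm z σ]
      refine (delta_four_le_of_inTriangle (hz.comp σ) hσ).trans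
        (pow_le_pow_left₀ (by norm_num) ?_ 2)
      have hs := one_lt_sqrt_five_sub_one
      have : (1.53 : ℝ) ^ 4 ≤ (5 * (√5 - 1) / 4) ^ 4 :=
        pow_le_pow_left₀ (by norm_num) (by linarith) 4
      norm_num at this ⊢
      linarith
    · rw [← delta_comp_perm z σ]
      exact delta_four_le_of_ordered (hz.comp σ) hσ
  · rw [delta_eq_zero_of_not_injective hinj]
    positivity

theorem delta_five_lt_of_inTriangle {z : Fin 5 → ℂ} (hz : Feasible z)
    (h : InTriangle (z 0) (z 1) (z 2) (z 3)) : delta z < (32 * (√5 - 1) ^ 5) ^ 2 := by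
  have h1 := h.prod_le (hz 1 2) (hz 2 3) (hz 3 1)
  have h4 := delta_four_le (hz.comp ![1, 2, 3, 4])
  rw [delta_four] at h4
  change (‖z 2 - z 1‖ * ‖z 3 - z 2‖ * ‖z 4 - z 3‖ * ‖z 1 - z 4‖ * ‖z 3 - z 1‖ * ‖z 4 - z 2‖) ^ 2 ≤ _
    at h4
  have hs := one_lt_sqrt_five_sub_one
  have h4' := le_of_sq_le_sq h4 (by positivity)
  rw [delta_five]
  refine pow_lt_pow_left₀ ?_ (by positivity) two_ne_zero
  rw [norm_sub_rev (z 0) (z 1), norm_sub_rev (z 0) (z 2)] at h1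
  set s := √5 - 1
  -- The ten distances split into three from the inner point to the triangle, one to the remaining
  -- point, and six among the other four points.
  calc _ = (‖z 1 - z 0‖ * ‖z 2 - z 0‖ * ‖z 0 - z 3‖) * ‖z 0 - z 4‖ * (‖z 2 - z 1‖ * ‖z 3 - z 2‖ *
        ‖z 4 - z 3‖ * ‖z 1 - z 4‖ * ‖z 3 - z 1‖ * ‖z 4 - z 2‖) := by ring
    _ ≤ 2 * 2 * (4 * (5 * s / 4) ^ 4) := by
        gcongr
        exact hz 0 4
    _ < 32 * s ^ 5 := by
        have : 0 < s ^ 4 := by positivity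
        nlinarith

/-! ### Recognizing a regular pentagon. -/

/-- The primitive fifth root of unity `exp (2πi/5)`. -/
noncomputable def zeta : ℂ := Complex.exp (((2 * Real.pi / 5 : ℝ) : ℂ) * Complex.I)

theorem zeta_re : zeta.re = (√5 - 1) / 4 := by
  rw [zeta, Complex.exp_ofReal_mul_I_re, ← sin_pi_div_ten, ← Real.cos_pi_div_two_sub]
  congr 1; ring

theorem zeta_im_pos : 0 < zeta.im := by
  rw [zeta, Complex.exp_ofReal_mul_I_im]
  exact Real.sin_pos_of_pos_of_lt_pi (by positivity) (by linarith [Real.pi_pos])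

theorem norm_zeta : ‖zeta‖ = 1 := Complex.norm_exp_ofReal_mul_I _

theorem zeta_re_sq_add_im_sq : zeta.re ^ 2 + zeta.im ^ 2 = 1 := by
  have h := Complex.sq_norm zeta
  rw [norm_zeta, Complex.normSq_apply] at h
  linarith

theorem exp_eq_zeta_pow (k : ℕ) :
    Complex.exp (2 * (Real.pi : ℂ) * Complex.I * (k : ℂ) / ((5 : ℕ) : ℂ)) = zeta ^ k := by
  rw [zeta, ← Complex.exp_nat_mul]
  congr 1; push_cast; ring

theorem zeta_pow_five : zeta ^ 5 = 1 := by
  rw [← exp_eq_zeta_pow]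
  convert Complex.exp_two_pi_mul_I using 2
  push_cast; ring

theorem zeta_ne_one : zeta ≠ 1 := fun h => by
  have := zeta_im_pos
  rw [h] at this
  simp at this

theorem isRegularPolygon_five_iff (z : Fin 5 → ℂ) : IsRegularPolygon z ↔
    ∃ (σ : Equiv.Perm (Fin 5)) (c w : ℂ), w ≠ 0 ∧ ∀ k : Fin 5, z (σ k) = c + w * zeta ^ (k : ℕ) := by
  unfold IsRegularPolygon
  simp only [exp_eq_zeta_pow]

theorem isRegularPolygon_of_comp_perm {n : ℕ} {z : Fin n → ℂ} (σ : Equiv.Perm (Fin n))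
    (h : IsRegularPolygon (z ∘ σ)) : IsRegularPolygon z := by
  obtain ⟨τ, c, w, hw, h⟩ := h
  exact ⟨τ.trans σ, c, w, hw, h⟩

theorem IsRegularPolygon.mul_left {n : ℕ} {z : Fin n → ℂ} {a : ℂ} (ha : a ≠ 0)
    (h : IsRegularPolygon z) : IsRegularPolygon fun i => a * z i := by
  obtain ⟨τ, c, w, hw, h⟩ := h
  refine ⟨τ, a * c, a * w, mul_ne_zero ha hw, fun k => ?_⟩
  simp only [h]; ring

/-- Side lengths and a diagonal determine the rotation between consecutive sides. -/
theorem sub_eq_zeta_mul {p q r : ℂ} (h1 : ‖q - p‖ = √5 - 1) (h2 : ‖r - q‖ = √5 - 1)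
    (h3 : ‖r - p‖ = 2) (ho : 0 < orient p q r) : r - q = zeta * (q - p) := by
  have h5 : √5 ^ 2 = 5 := Real.sq_sqrt (by norm_num)
  have hs := one_lt_sqrt_five_sub_one
  have e1 := Complex.sq_norm (q - p)
  have e2 := Complex.sq_norm (r - q)
  have e3 := Complex.sq_norm (r - p)
  rw [h1, Complex.normSq_apply, Complex.sub_re, Complex.sub_im] at e1
  rw [h2, Complex.normSq_apply, Complex.sub_re, Complex.sub_im] at e2
  rw [h3, Complex.normSq_apply, Complex.sub_re, Complex.sub_im] at e3
  have hre := zeta_re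
  have hn := zeta_re_sq_add_im_sq
  have him := zeta_im_pos
  -- The dot product comes from the law of cosines; the cross product then has known square, and
  -- orientation fixes its sign.
  have hdot : (q.re - p.re) * (r.re - q.re) + (q.im - p.im) * (r.im - q.im) =
      (√5 - 1) ^ 2 * zeta.re := by
    rw [hre]; linear_combination (-1 / 2) * e3 + e1 / 2 + e2 / 2 - (√5 + 1) / 4 * h5
  have hc : orient p q r =
      (q.re - p.re) * (r.im - q.im) - (q.im - p.im) * (r.re - q.re) := by
    unfold orient; ring
  have hcross : orient p q r = (√5 - 1) ^ 2 * zeta.im := by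
    have hsq : orient p q r ^ 2 = ((√5 - 1) ^ 2 * zeta.im) ^ 2 := by
      have hL : orient p q r ^ 2 + ((q.re - p.re) * (r.re - q.re) +
          (q.im - p.im) * (r.im - q.im)) ^ 2 = (√5 - 1) ^ 2 * (√5 - 1) ^ 2 := by
        rw [hc]
        nth_rewrite 1 [e1]
        rw [e2]
        ring
      rw [hdot] at hL
      linear_combination hL - (√5 - 1) ^ 4 * hn
    exact (pow_left_inj₀ ho.le (by positivity) two_ne_zero).1 hsq
  rw [hc] at hcross
  have hs2 : (√5 - 1) ^ 2 ≠ 0 := by positivity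
  apply Complex.ext
  · apply mul_left_cancel₀ hs2
    rw [Complex.sub_re, Complex.mul_re, Complex.sub_re, Complex.sub_im]
    linear_combination (r.re - q.re) * e1 + (q.re - p.re) * hdot - (q.im - p.im) * hcross
  · apply mul_left_cancel₀ hs2
    rw [Complex.sub_im, Complex.mul_im, Complex.sub_re, Complex.sub_im]
    linear_combination (r.im - q.im) * e1 + (q.im - p.im) * hdot + (q.re - p.re) * hcross

/-- Consecutive sides form a geometric progression of ratio ζ, so the vertices are its partial sums;
four sides and three diagonals suffice. -/
theorem isRegularPolygon_of_ordered {z : Fin 5 → ℂ} (ho : Ordered z)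
    (s0 : ‖z 1 - z 0‖ = √5 - 1) (s1 : ‖z 2 - z 1‖ = √5 - 1) (s2 : ‖z 3 - z 2‖ = √5 - 1)
    (s3 : ‖z 4 - z 3‖ = √5 - 1) (d0 : ‖z 2 - z 0‖ = 2) (d1 : ‖z 3 - z 1‖ = 2)
    (d2 : ‖z 4 - z 2‖ = 2) : IsRegularPolygon z := by
  have h2 := sub_eq_zeta_mul s0 s1 d0 (ho 0 1 2 (by decide) (by decide))
  have h3 := sub_eq_zeta_mul s1 s2 d1 (ho 1 2 3 (by decide) (by decide))
  have h4 := sub_eq_zeta_mul s2 s3 d2 (ho 2 3 4 (by decide) (by decide))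
  have hζ : zeta - 1 ≠ 0 := sub_ne_zero.2 zeta_ne_one
  have hne : z 1 - z 0 ≠ 0 := by
    rw [← norm_ne_zero_iff, s0]; linarith [one_lt_sqrt_five_sub_one]
  set w := (z 1 - z 0) / (zeta - 1) with hw
  have hv : z 1 - z 0 = w * (zeta - 1) := by rw [hw, div_mul_cancel₀ _ hζ]
  have h1' : z 1 = z 0 + w * (zeta - 1) := by linear_combination hv
  have h2' : z 2 = z 0 + w * (zeta ^ 2 - 1) := by linear_combination h2 + (1 + zeta) * hv
  have h3' : z 3 = z 0 + w * (zeta ^ 3 - 1) := by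
    linear_combination h3 + (1 + zeta) * h2 + (1 + zeta + zeta ^ 2) * hv
  have h4' : z 4 = z 0 + w * (zeta ^ 4 - 1) := by
    linear_combination h4 + (1 + zeta) * h3 + (1 + zeta + zeta ^ 2) * h2 +
      (1 + zeta + zeta ^ 2 + zeta ^ 3) * hv
  rw [isRegularPolygon_five_iff]
  refine ⟨Equiv.refl _, z 0 - w, w, div_ne_zero hne hζ, fun k => ?_⟩
  fin_cases k
  · change z 0 = _ + w * zeta ^ 0
    ring
  · change z 1 = _ + w * zeta ^ 1
    rw [h1']; ring
  · change z 2 = _ + w * zeta ^ 2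
    rw [h2']; ring
  · change z 3 = _ + w * zeta ^ 3
    rw [h3']; ring
  · change z 4 = _ + w * zeta ^ 4
    rw [h4']; ring

/-! ### Diameter, the sharp bound and its equality case. -/

theorem norm_sub_le_diameter {n : ℕ} (z : Fin n → ℂ) (i j : Fin n) : ‖z i - z j‖ ≤ diameter z := by
  rw [← dist_eq_norm]
  exact Metric.dist_le_diam_of_mem (Set.finite_range z).isBounded ⟨i, rfl⟩ ⟨j, rfl⟩

theorem diameter_eq {n : ℕ} {z : Fin n → ℂ} {D : ℝ} (h : ∀ i j, ‖z i - z j‖ ≤ D) {i j : Fin n}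
    (hij : ‖z i - z j‖ = D) : diameter z = D := by
  refine le_antisymm (Metric.diam_le_of_forall_dist_le (hij ▸ norm_nonneg _) ?_)
    (hij ▸ norm_sub_le_diameter z i j)
  rintro _ ⟨a, rfl⟩ _ ⟨b, rfl⟩
  rw [dist_eq_norm]
  exact h a b

theorem diameter_comp_perm {n : ℕ} (z : Fin n → ℂ) (σ : Equiv.Perm (Fin n)) :
    diameter (z ∘ σ) = diameter z := by
  unfold diameter
  rw [σ.surjective.range_comp]

theorem diameter_mul_left {n : ℕ} (z : Fin n → ℂ) (a : ℂ) :
    diameter (fun i => a * z i) = ‖a‖ * diameter z := by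
  unfold diameter
  rw [← diam_smul₀]
  congr 1
  ext x
  simp [Set.mem_smul_set]

/-- The bound and its equality case in convex position. -/
theorem delta_five_of_ordered {z : Fin 5 → ℂ} (hz : Feasible z) (ho : Ordered z) :
    delta z ≤ (32 * (√5 - 1) ^ 5) ^ 2 ∧
      (delta z = (32 * (√5 - 1) ^ 5) ^ 2 → IsRegularPolygon z ∧ diameter z = 2) := by
  have hs := one_lt_sqrt_five_sub_one
  have hp := pentagon_perimeter_le
    (ho.notAlternating (i := 0) (j := 1) (k := 2) (l := 3) (by decide) (by decide) (by decide))
    (ho.notAlternating (i := 0) (j := 1) (k := 2) (l := 4) (by decide) (by decide) (by decide))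
    (ho.notAlternating (i := 0) (j := 1) (k := 3) (l := 4) (by decide) (by decide) (by decide))
    (ho.notAlternating (i := 0) (j := 2) (k := 3) (l := 4) (by decide) (by decide) (by decide))
    (ho.notAlternating (i := 1) (j := 2) (k := 3) (l := 4) (by decide) (by decide) (by decide))
    (hz _ _) (hz _ _) (hz _ _) (hz _ _) (hz _ _) (hz _ _) (hz _ _) (hz _ _) (hz _ _) (hz _ _)
  set s := √5 - 1 with hsdef
  have s0 : 0 < s := by linarith
  obtain ⟨hr1, hr2⟩ := prod_le_one_of_sum_le (fun k : Fin 5 => ‖z (k + 1) - z k‖ / s)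
    (fun k => div_nonneg (norm_nonneg _) s0.le) (by
      rw [← Finset.sum_div, div_le_iff₀ s0, Fin.sum_univ_five]
      exact hp)
  obtain ⟨ht1, ht2⟩ := prod_le_one_of_sum_le (fun k : Fin 5 => ‖z (k + 2) - z k‖ / 2)
    (fun k => div_nonneg (norm_nonneg _) two_pos.le) (by
      rw [← Finset.sum_div, div_le_iff₀ two_pos]
      refine (Finset.sum_le_card_nsmul _ _ 2 fun k _ => hz _ _).trans ?_
      simp)
  set R := ∏ k : Fin 5, ‖z (k + 1) - z k‖ / s with hR
  set T := ∏ k : Fin 5, ‖z (k + 2) - z k‖ / 2 with hT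
  have hR0 : 0 ≤ R := Finset.prod_nonneg fun k _ => div_nonneg (norm_nonneg _) s0.le
  have hT0 : 0 ≤ T := Finset.prod_nonneg fun k _ => div_nonneg (norm_nonneg _) two_pos.le
  have hδ : delta z = (32 * s ^ 5 * (R * T)) ^ 2 := by
    have h1 : delta z = ((∏ k : Fin 5, ‖z (k + 1) - z k‖) * ∏ k : Fin 5, ‖z (k + 2) - z k‖) ^ 2 := by
      rw [delta_five, Fin.prod_univ_five, Fin.prod_univ_five]
      rfl
    have hRe : ∏ k : Fin 5, ‖z (k + 1) - z k‖ = s ^ 5 * R := by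
      rw [hR, Finset.prod_div_distrib, Finset.prod_const, Finset.card_univ, Fintype.card_fin,
        mul_div_cancel₀ _ (by positivity)]
    have hTe : ∏ k : Fin 5, ‖z (k + 2) - z k‖ = 2 ^ 5 * T := by
      rw [hT, Finset.prod_div_distrib, Finset.prod_const, Finset.card_univ, Fintype.card_fin,
        mul_div_cancel₀ _ (by positivity)]
    rw [h1, hRe, hTe]
    ring
  have hRT : R * T ≤ 1 := mul_le_one₀ hr1 hT0 ht1
  have hM : 0 < 32 * s ^ 5 := by positivity
  refine ⟨?_, fun h => ?_⟩
  · rw [hδ]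
    exact pow_le_pow_left₀ (by positivity) (mul_le_of_le_one_right hM.le hRT) 2
  -- Equality forces RT = 1 with both factors at most 1, hence equality in AM-GM for the sides and
  -- for the diagonals.
  · rw [hδ, pow_left_inj₀ (by positivity) hM.le two_ne_zero, mul_eq_left₀ hM.ne'] at h
    have hR1 : R = 1 := le_antisymm hr1 (by nlinarith)
    have hT1 : T = 1 := le_antisymm ht1 (by nlinarith)
    have hr : ∀ k : Fin 5, ‖z (k + 1) - z k‖ = s := fun k =>
      (div_eq_one_iff_eq s0.ne').1 (hr2 hR1 k)
    have ht : ∀ k : Fin 5, ‖z (k + 2) - z k‖ = 2 := fun k =>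
      (div_eq_one_iff_eq two_ne_zero).1 (ht2 hT1 k)
    exact ⟨isRegularPolygon_of_ordered ho (hr 0) (hr 1) (hr 2) (hr 3) (ht 0) (ht 1) (ht 2),
      diameter_eq hz (ht 0)⟩

theorem delta_five_le {z : Fin 5 → ℂ} (hz : Feasible z) :
    delta z ≤ (32 * (√5 - 1) ^ 5) ^ 2 ∧
      (delta z = (32 * (√5 - 1) ^ 5) ^ 2 → IsRegularPolygon z ∧ diameter z = 2) := by
  have hs := one_lt_sqrt_five_sub_one
  by_cases hinj : Function.Injective z
  · rcases hasInnerPoint_or_exists_order (by norm_num) z hinj with h | ⟨σ, hσ⟩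
    · obtain ⟨σ, hσ⟩ := exists_perm_of_hasInnerPoint_five h
      have hlt := delta_five_lt_of_inTriangle (hz.comp σ) hσ
      rw [delta_comp_perm] at hlt
      exact ⟨hlt.le, fun h => absurd h hlt.ne⟩
    · have h := delta_five_of_ordered (hz.comp σ) hσ
      rw [delta_comp_perm, diameter_comp_perm] at h
      exact ⟨h.1, fun he => ⟨isRegularPolygon_of_comp_perm σ (h.2 he).1, (h.2 he).2⟩⟩
  · have hM : (0 : ℝ) < 32 * (√5 - 1) ^ 5 := by positivity
    have hlt : delta z < (32 * (√5 - 1) ^ 5) ^ 2 := by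
      rw [delta_eq_zero_of_not_injective hinj]; positivity
    exact ⟨hlt.le, fun h => absurd h hlt.ne⟩

/-! ### Values on regular pentagons and rescaling. -/

/-- The ratio of diagonal to side is |ζ + 1|, the golden ratio, whose inverse is (√5 - 1)/2. -/
theorem norm_zeta_sub_one_eq : ‖zeta - 1‖ = ‖zeta ^ 2 - 1‖ * ((√5 - 1) / 2) := by
  have h5 : √5 ^ 2 = 5 := Real.sq_sqrt (by norm_num)
  have h1 : ‖zeta + 1‖ = (√5 + 1) / 2 := by
    refine (pow_left_inj₀ (norm_nonneg _) (by positivity) two_ne_zero).1 ?_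
    rw [Complex.sq_norm, Complex.normSq_apply, Complex.add_re, Complex.add_im, Complex.one_re,
      Complex.one_im]
    linear_combination zeta_re_sq_add_im_sq + 2 * zeta_re - h5 / 4
  rw [show zeta ^ 2 - 1 = (zeta - 1) * (zeta + 1) by ring, norm_mul, h1]
  linear_combination -‖zeta - 1‖ / 4 * h5

/-- Values on a regular pentagon. -/
theorem IsRegularPolygon.delta_eq {z : Fin 5 → ℂ} (h : IsRegularPolygon z) :
    0 < diameter z ∧ delta z = (diameter z ^ 10 * ((√5 - 1) / 2) ^ 5) ^ 2 := by
  obtain ⟨σ, c, w, hw, h⟩ := (isRegularPolygon_five_iff z).1 h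
  rw [← diameter_comp_perm z σ, ← delta_comp_perm z σ]
  have hs := one_lt_sqrt_five_sub_one
  have hs2 : (√5 - 1) / 2 ≤ 1 := by
    have : √5 ≤ 3 := Real.sqrt_le_iff.2 ⟨by norm_num, by norm_num⟩
    linarith
  set D := ‖w‖ * ‖zeta ^ 2 - 1‖ with hD
  set y := z ∘ σ with hy
  have hD0 : 0 < D := by
    have h1 : 0 < ‖zeta - 1‖ := norm_pos_iff.2 (sub_ne_zero.2 zeta_ne_one)
    rw [norm_zeta_sub_one_eq] at h1
    exact mul_pos (norm_pos_iff.2 hw) (pos_of_mul_pos_left h1 (by linarith))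
  have hstep : ∀ (k m : ℕ), ‖w * zeta ^ (k + m) - w * zeta ^ k‖ = ‖w‖ * ‖zeta ^ m - 1‖ := by
    intro k m
    rw [show w * zeta ^ (k + m) - w * zeta ^ k = w * zeta ^ k * (zeta ^ m - 1) by ring, norm_mul,
      norm_mul, norm_pow, norm_zeta, one_pow, mul_one]
  have hval : ∀ k : Fin 5, y k = c + w * zeta ^ (k : ℕ) := h
  -- Addition in `Fin 5` wraps around, which is harmless because ζ⁵ = 1.
  have hmod : ∀ (k : Fin 5) (m : Fin 5), y (k + m) = c + w * zeta ^ ((k : ℕ) + (m : ℕ)) := by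
    intro k m
    rw [hval, Fin.val_add, ← pow_mod_orderOf zeta ((k : ℕ) + m), ← pow_mod_orderOf zeta (_ % 5),
      Nat.mod_mod_of_dvd _ (orderOf_dvd_of_pow_eq_one zeta_pow_five)]
  have hdist : ∀ k m : Fin 5, ‖y (k + m) - y k‖ = ‖w‖ * ‖zeta ^ (m : ℕ) - 1‖ := by
    intro k m
    rw [hmod, hval, add_sub_add_left_eq_sub, hstep]
  have hside : ∀ k, ‖y (k + 1) - y k‖ = D * ((√5 - 1) / 2) := by
    intro k
    rw [hdist, Fin.val_one, pow_one, norm_zeta_sub_one_eq, hD, mul_assoc]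
  have hdiag : ∀ k, ‖y (k + 2) - y k‖ = D := fun k => hdist k 2
  have hle : ∀ i j, ‖y i - y j‖ ≤ D := by
    have hsD : D * ((√5 - 1) / 2) ≤ D := mul_le_of_le_one_right hD0.le hs2
    have hcases : ∀ i j : Fin 5, i = j ∨ i = j + 1 ∨ i = j + 2 ∨ j = i + 1 ∨ j = i + 2 := by decide
    intro i j
    rcases hcases i j with rfl | rfl | rfl | rfl | rfl
    · rw [sub_self, norm_zero]; exact hD0.le
    · rw [hside]; exact hsD
    · rw [hdiag]
    · rw [norm_sub_rev, hside]; exact hsD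
    · rw [norm_sub_rev, hdiag]
  rw [diameter_eq hle (hdiag 0)]
  refine ⟨hD0, ?_⟩
  rw [delta_five]
  have a0 := hside 0
  have a1 := hside 1
  have a2 := hside 2
  have a3 := hside 3
  have a4 := hside 4
  have b0 := hdiag 0
  have b1 := hdiag 1
  have b2 := hdiag 2
  have b3 := hdiag 3
  have b4 := hdiag 4
  simp only [Fin.reduceAdd] at a0 a1 a2 a3 a4 b0 b1 b2 b3 b4
  rw [a0, a1, a2, a3, a4, b0, b1, b2, b3, b4]
  ring

theorem IsRegularPolygon.delta_eq_of_diameter_eq_two {z : Fin 5 → ℂ} (h : IsRegularPolygon z)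
    (hd : diameter z = 2) : delta z = (32 * (√5 - 1) ^ 5) ^ 2 := by
  rw [h.delta_eq.2, hd]; ring

theorem feasible_of_diameter_le {n : ℕ} {z : Fin n → ℂ} (h : diameter z ≤ 2) : Feasible z :=
  fun i j => (norm_sub_le_diameter z i j).trans h

theorem diameter_rescale {n : ℕ} {z : Fin n → ℂ} (h : 0 < diameter z) :
    diameter (fun i => ((2 / diameter z : ℝ) : ℂ) * z i) = 2 := by
  rw [diameter_mul_left, Complex.norm_real, Real.norm_of_nonneg (by positivity),
    div_mul_cancel₀ _ h.ne']

theorem isRegularPolygon_rescale_iff {n : ℕ} {z : Fin n → ℂ} {t : ℝ} (ht : t ≠ 0) :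
    IsRegularPolygon (fun i => (t : ℂ) * z i) ↔ IsRegularPolygon z := by
  have ht' : (t : ℂ) ≠ 0 := by exact_mod_cast ht
  refine ⟨fun h => ?_, fun h => h.mul_left ht'⟩
  simpa [inv_mul_cancel_left₀ ht'] using h.mul_left (inv_ne_zero ht')

theorem exists_isRegularPolygon_five : ∃ z : Fin 5 → ℂ, IsRegularPolygon z ∧ diameter z = 2 := by
  have h : IsRegularPolygon fun k : Fin 5 => zeta ^ (k : ℕ) :=
    (isRegularPolygon_five_iff _).2 ⟨Equiv.refl _, 0, 1, one_ne_zero, fun k => by simp⟩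
  have hd := h.delta_eq.1
  exact ⟨_, (isRegularPolygon_rescale_iff (by positivity)).2 h, diameter_rescale hd⟩

theorem deltaMax_five : deltaMax 5 = (32 * (√5 - 1) ^ 5) ^ 2 := by
  refine IsGreatest.csSup_eq ⟨?_, ?_⟩
  · obtain ⟨z, hz, hd⟩ := exists_isRegularPolygon_five
    exact ⟨z, feasible_of_diameter_le hd.le, (hz.delta_eq_of_diameter_eq_two hd).symm⟩
  · rintro _ ⟨z, hz, rfl⟩
    exact (delta_five_le hz).1

theorem delta_eq_deltaMax_five_iff {z : Fin 5 → ℂ} (hz : Feasible z) :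
    delta z = deltaMax 5 ↔ IsRegularPolygon z ∧ diameter z = 2 := by
  rw [deltaMax_five]
  exact ⟨(delta_five_le hz).2, fun h => h.1.delta_eq_of_diameter_eq_two h.2⟩

end PointConfiguration

theorem mainTheorem7 :
    PointConfiguration.normalizedDeltaMax 5 = (4 / 5 : ℝ) ^ 5 * (Real.sqrt 5 - 1) ^ 10 ∧
    (∃ z : Fin 5 → ℂ, PointConfiguration.diameter z = 2 ∧
      PointConfiguration.delta z = PointConfiguration.deltaMax 5) ∧
    (∀ z : Fin 5 → ℂ, PointConfiguration.Feasible z →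
      (PointConfiguration.delta z = PointConfiguration.deltaMax 5 ↔
        PointConfiguration.IsRegularPolygon z ∧ PointConfiguration.diameter z = 2)) ∧
    (∀ z : Fin 5 → ℂ, 0 < PointConfiguration.diameter z →
      (PointConfiguration.normalizedDelta z = PointConfiguration.normalizedDeltaMax 5 ↔
        PointConfiguration.IsRegularPolygon z)) := by
  refine ⟨?_, ?_, fun z hz => PointConfiguration.delta_eq_deltaMax_five_iff hz, fun z hz => ?_⟩
  · rw [PointConfiguration.normalizedDeltaMax, PointConfiguration.deltaMax_five]
    push_cast
    ring
  · obtain ⟨z, hz, hd⟩ := PointConfiguration.exists_isRegularPolygon_five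
    exact ⟨z, hd, (PointConfiguration.delta_eq_deltaMax_five_iff
      (PointConfiguration.feasible_of_diameter_le hd.le)).2 ⟨hz, hd⟩⟩
  · have hd := PointConfiguration.diameter_rescale hz
    rw [PointConfiguration.normalizedDelta, PointConfiguration.normalizedDeltaMax,
      div_left_inj' (by norm_num), PointConfiguration.delta_eq_deltaMax_five_iff
      (PointConfiguration.feasible_of_diameter_le hd.le), and_iff_left hd,
      PointConfiguration.isRegularPolygon_rescale_iff (by positivity)]
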